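/- A planar bar-joint framework $(G,p)$ consists of a simple graph $G=(V,E)$, whose vertices are called joints and whose edges are called bars, and a placement $p:V\to\mathbb{R}^2$, $v\mapsto p_v$, with $p_v\neq p_w$ for every bar $vw$ (different joints may occupy the same point, and bars may cross). A continuous motion of $(G,p)$ is a family of maps $q(t):V\to\mathbb{R}^2$, $t\in[0,1]$, with $q(0)=p$, such that $t\mapsto q_v(t)$ is continuous for every joint $v$, and $|q_v(t)-q_w(t)|=|p_v-p_w|$ for every bar $vw$ and every $t\in[0,1]$. Theorem. Let $\gamma:[0,1]\to\mathbb{R}^2$ be a continuous function. Then there are a planar bar-joint framework $(G,p)$ with countably infinitely many joints, for which there is a finite uniform bound on the number of bars incident to a joint, and four distinct joints $1,2,L,C$ of it with $p_1=(0,0)$, $p_2=(1,0)$, $p_L=(1,0)$, $p_C=\gamma(0)$, such that the following holds. For every continuous motion $q(t)$, $t\in[0,1]$, of $(G,p)$ with $q_1(t)=p_1$, $q_2(t)=p_2$ and $q_L(t)=(1+s(t),0)$ with $s(t)\in[0,1]$ for all $t$, we have $q_C(t)=\gamma(s(t))$ for all $t\in[0,1]$. Moreover, there exists such a motion with $s(t)=t$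 for all $t\in[0,1]$. -/

import Mathlib

open scoped unitInterval

/-- The Euclidean plane. -/
abbrev Plane : Type := EuclideanSpace ℝ (Fin 2)

/-- A bar-joint framework in the plane: a simple graph (vertices are joints, edges are bars)
together with a placement of the joints such that every bar has nonzero length. Distinct joints
may occupy the same point and bars may cross. -/
structure PlanarFramework (V : Type*) where
  /-- the underlying graph -/
  graph : SimpleGraph V
  /-- the placement of the joints -/
  place : V → Plane
  /-- the two ends of a bar are different points -/
  place_ne : ∀ ⦃v w : V⦄, graph.Adj v w → place v ≠ place w

namespace PlanarFramework

variable {V : Type*}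

/-- All joints are incident to at most `d` bars. -/
def ValencyLE (F : PlanarFramework V) (d : ℕ) : Prop :=
  ∀ v : V, (F.graph.neighborSet v).encard ≤ (d : ℕ∞)

/-- A continuous motion of the framework over the time interval `[0,1]`: it starts at the given
placement, every joint moves continuously, and the length of every bar is preserved. -/
structure IsContinuousMotion (F : PlanarFramework V) (q : I → V → Plane) : Prop where
  start : ∀ v : V, q 0 v = F.place v
  continuous_joint : ∀ v : V, Continuous fun t : I => q t v
  dist_eq : ∀ (t : I) ⦃v w : V⦄, F.graph.Adj v w →
    dist (q t v) (q t w) = dist (F.place v) (F.place w)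

/-- A continuous motion in which the joints `v₁` and `v₂` stay fixed and the joint `vL` is at
`(1 + s t, 0)` at time `t`. -/
structure IsDrivenMotion (F : PlanarFramework V) (v₁ v₂ vL : V) (s : I → I)
    (q : I → V → Plane) : Prop where
  motion : F.IsContinuousMotion q
  fixed₁ : ∀ t : I, q t v₁ = F.place v₁
  fixed₂ : ∀ t : I, q t v₂ = F.place v₂
  input : ∀ t : I, q t vL = !₂[1 + (s t : ℝ), 0]

end PlanarFramework

/-!
The plane is identified with `ℂ`, and a joint of the linkage with the continuous function `I → ℂ`
giving its intended position at input parameter `x`. A countable set of such functions becomes a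
linkage by putting a bar between any two functions at constant distance. It moves as intended by
construction, and enlarging the set only adds constraints, so the work is to show that every
continuous function is `Traceable`: some countable set of further joints forces it to its intended
position. The valency of these linkages is infinite.

* An isosceles triangle on the base from `0` to the input joint `1 + x` never flattens if its legs
  are long, so its apex, the `crank`, cannot flip (`Traceable.of_noncollinear`).
* The bars from `0` to traceable joints at constant distance from `0` can be rotated and scaled
  (`smul_mem_radialJoints`), and carried to other places by parallelograms braced along their
  midlines, which do not flip even when flat (`Traceable.parallelogram`). Hence all complex linear
  combinations of cranks are traceable (`traceable_of_mem_span`).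
* The difference of the cranks above and below the axis is a multiple of `√(1 - ε y)`, where
  `y = ((1 + x) / 2) ^ 2`. Since no Taylor coefficient of the square root vanishes, the closed span
  of these functions contains all powers of `y`, so by Stone-Weierstrass the combinations of cranks
  are dense (`dense_span_radialJoints`). No linkage that multiplies angles is needed.
* A uniform limit is enforced by joining it to each of its approximations through an elbow of two
  bars whose length tends to `0` (`traceable`).

Finally, any countable framework can be replaced by one of bounded valency with the same motions, by
splitting each joint into an infinite sequence of copies that are forced to coincide
(`PlanarFramework.expand`).
-/

/-! ### Square roots and uniform approximation -/

/-- Taylor expansion of `√(1 + u)` at `0` to any order; no coefficient vanishes, which is what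
allows all powers to be extracted from square roots in `pow_mem_of_sqrt_mem`. -/
theorem exists_sqrt_one_add_taylor : ∃ b : ℕ → ℝ, (∀ k, b k ≠ 0) ∧
    ∀ n, ∃ C δ : ℝ, 0 < C ∧ 0 < δ ∧ ∀ u : ℝ, |u| < δ →
      |√(1 + u) - ∑ j ∈ Finset.range n, b j * u ^ j| ≤ C * |u| ^ n := by
  refine ⟨fun k => Ring.choose (1 / 2 : ℝ) k, fun k => ?_, fun n => ?_⟩
  · simp only
    rw [Ring.choose_eq_smul, smul_eq_mul]
    refine mul_ne_zero (by positivity) ?_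
    induction k with
    | zero => simp
    | succ k ih =>
      rw [descPochhammer_succ_right, Polynomial.smeval_mul]
      refine mul_ne_zero ih ?_
      have : (1 / 2 : ℝ) - k ≠ 0 := by
        intro h
        have h2 : (1 : ℝ) = 2 * k := by linarith
        have h3 : (1 : ℕ) = 2 * k := by exact_mod_cast h2
        omega
      simpa [Polynomial.smeval_sub, Polynomial.smeval_X, Polynomial.smeval_natCast] using this
  · have h := (Real.one_add_rpow_hasFPowerSeriesAt_zero (a := 1 / 2)).isBigO_sub_partialSum_pow n
    obtain ⟨C, hC, hb⟩ := h.exists_pos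
    rw [Asymptotics.IsBigOWith, Metric.eventually_nhds_iff] at hb
    obtain ⟨δ, hδ, hb⟩ := hb
    refine ⟨C, δ, hC, hδ, fun u hu => ?_⟩
    have := hb (y := u) (by simpa [Real.dist_eq] using hu)
    simpa [FormalMultilinearSeries.partialSum, binomialSeries, Real.sqrt_eq_rpow,
      mul_comm] using this

section Density

variable {X : Type*} [TopologicalSpace X] [CompactSpace X]

/-- The function `√(1 - ε y)`. -/
noncomputable def sqrtOneSub (y : C(X, ℝ)) (ε : ℝ) : C(X, ℝ) :=
  ⟨fun x => √(1 - ε * y x), by fun_prop⟩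

/-- Dividing the Taylor remainder of `√(1 - ε y)` by the leading power of `ε` and letting `ε → 0`
produces the powers of `y` one after the other. -/
theorem pow_mem_of_sqrt_mem {W : Submodule ℝ C(X, ℝ)} (hW : IsClosed (W : Set C(X, ℝ)))
    {y : C(X, ℝ)} (hy : ∀ x, |y x| ≤ 1)
    (h : ∀ ε : ℝ, 0 < ε → ε ≤ 1 / 2 → sqrtOneSub y ε ∈ W) (k : ℕ) : y ^ k ∈ W := by
  obtain ⟨b, hb, hT⟩ := exists_sqrt_one_add_taylor
  induction k using Nat.strong_induction_on with
  | _ k ih =>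
    obtain ⟨C, δ, hC, hδ, hest⟩ := hT (k + 1)
    have hc : b k * (-1) ^ k ≠ 0 := mul_ne_zero (hb k) (by simp)
    suffices hmem : (b k * (-1) ^ k) • y ^ k ∈ W by
      have := W.smul_mem (b k * (-1) ^ k)⁻¹ hmem
      rwa [smul_smul, inv_mul_cancel₀ hc, one_smul] at this
    rw [← SetLike.mem_coe, ← hW.closure_eq, Metric.mem_closure_iff]
    intro η hη
    obtain ⟨ε, hε0, hε⟩ : ∃ ε : ℝ, 0 < ε ∧ ε < min (min (1 / 2) δ) (η / C) :=
      exists_between (by positivity)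
    simp only [lt_min_iff] at hε
    obtain ⟨⟨hε1, hε2⟩, hε3⟩ := hε
    refine ⟨(ε ^ k)⁻¹ • (sqrtOneSub y ε - ∑ j ∈ Finset.range k, (b j * (-ε) ^ j) • y ^ j),
      W.smul_mem _ (W.sub_mem (h ε hε0 hε1.le)
        (W.sum_mem fun j hj => W.smul_mem _ (ih j (Finset.mem_range.1 hj)))), ?_⟩
    rw [dist_comm, ContinuousMap.dist_lt_iff hη]
    intro x
    have hu : |-(ε * y x)| ≤ ε := by
      rw [abs_neg, abs_mul, abs_of_pos hε0]
      exact mul_le_of_le_one_right hε0.le (hy x)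
    have hE := hest (-(ε * y x)) (hu.trans_lt hε2)
    have hpow : |-(ε * y x)| ^ (k + 1) ≤ ε ^ (k + 1) := pow_le_pow_left₀ (abs_nonneg _) hu _
    have hεk : 0 < ε ^ k := by positivity
    rw [Finset.sum_range_succ, ← sub_eq_add_neg] at hE
    have hcalc : ((ε ^ k)⁻¹ • (sqrtOneSub y ε
        - ∑ j ∈ Finset.range k, (b j * (-ε) ^ j) • y ^ j)) x - ((b k * (-1) ^ k) • y ^ k) x
        = (ε ^ k)⁻¹ * (√(1 - ε * y x) - (∑ j ∈ Finset.range k, b j * (-(ε * y x)) ^ j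
          + b k * (-(ε * y x)) ^ k)) := by
      have h1 : ∑ j ∈ Finset.range k, b j * (-(ε * y x)) ^ j
          = ∑ j ∈ Finset.range k, b j * (-ε) ^ j * y x ^ j :=
        Finset.sum_congr rfl fun j _ => by rw [← neg_mul, mul_pow, mul_assoc]
      have h2 : (-(ε * y x)) ^ k = (-1) ^ k * ε ^ k * y x ^ k := by
        rw [neg_pow, mul_pow, mul_assoc]
      rw [h1, h2]
      simp only [ContinuousMap.coe_smul, ContinuousMap.coe_sub, Pi.smul_apply, Pi.sub_apply,
        sqrtOneSub, ContinuousMap.coe_mk, ContinuousMap.coe_sum, Finset.sum_apply,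
        ContinuousMap.coe_pow, Pi.pow_apply, smul_eq_mul]
      field_simp
      ring
    rw [Real.dist_eq, hcalc, abs_mul, abs_inv, abs_of_pos hεk, inv_mul_lt_iff₀ hεk]
    calc _ ≤ C * |-(ε * y x)| ^ (k + 1) := hE
      _ ≤ C * ε ^ (k + 1) := by gcongr
      _ = ε ^ k * (C * ε) := by ring
      _ < ε ^ k * η := by
        gcongr
        rwa [lt_div_iff₀ hC, mul_comm] at hε3

/-- If `y` separates points, a closed subspace containing all `√(1 - ε y)` is everything. -/
theorem eq_top_of_sqrt_mem {W : Submodule ℝ C(X, ℝ)} (hW : IsClosed (W : Set C(X, ℝ)))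
    {y : C(X, ℝ)} (hy : ∀ x, |y x| ≤ 1) (hinj : Function.Injective y)
    (h : ∀ ε : ℝ, 0 < ε → ε ≤ 1 / 2 → sqrtOneSub y ε ∈ W) : W = ⊤ := by
  have hsub : (Algebra.adjoin ℝ {y} : Set C(X, ℝ)) ⊆ W := by
    intro f hf
    rw [SetLike.mem_coe, Algebra.adjoin_singleton_eq_range_aeval] at hf
    obtain ⟨p, rfl⟩ := hf
    change Polynomial.aeval y p ∈ W
    rw [Polynomial.aeval_eq_sum_range]
    exact W.sum_mem fun j _ => W.smul_mem _ (pow_mem_of_sqrt_mem hW hy h j)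
  have htop := ContinuousMap.subalgebra_topologicalClosure_eq_top_of_separatesPoints
    (Algebra.adjoin ℝ {y}) (fun a b hab => ⟨y, ⟨y, Algebra.self_mem_adjoin_singleton ℝ y, rfl⟩,
      fun hxy => hab (hinj hxy)⟩)
  refine eq_top_iff.2 fun f _ => ?_
  have hf : f ∈ (Algebra.adjoin ℝ {y}).topologicalClosure := by rw [htop]; trivial
  exact closure_minimal hsub hW hf

end Density

/-! ### Functions forced by a linkage -/

/-- The position `1 + x` of the input joint, as a function of the input parameter. -/
noncomputable def inputPath : C(I, ℂ) := ⟨fun x => 1 + ((x : ℝ) : ℂ), by fun_prop⟩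

/-- Regard a set `V` of functions `I → ℂ` as a linkage: the joints are the functions, `f` is
intended to be at `f x` when the input parameter is `x`, and there is a bar between any two joints
whose intended distance is independent of `x`. Then `IsDrivenFlex V s q` says that `q t f`, for
`f ∈ V`, is a continuous motion of this linkage in which the joints `0` and `1` are fixed and the
joint `inputPath` is at `1 + s t`. The values of `q` outside `V` are irrelevant; that `q` is
defined there makes it possible to vary `V`. -/
structure IsDrivenFlex (V : Set C(I, ℂ)) (s : I → I) (q : I → C(I, ℂ) → ℂ) : Prop where
  start : ∀ f ∈ V, q 0 f = f 0
  cont : ∀ f ∈ V, Continuous fun t => q t f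
  bar : ∀ t, ∀ f ∈ V, ∀ g ∈ V, (∀ x, ‖f x - g x‖ = ‖f 0 - g 0‖) →
    ‖q t f - q t g‖ = ‖f 0 - g 0‖
  zero : ∀ t, q t 0 = 0
  one : ∀ t, q t 1 = 1
  input : ∀ t, q t inputPath = inputPath (s t)

/-- The three joints whose motion is prescribed. -/
noncomputable def baseJoints : Set C(I, ℂ) := {0, 1, inputPath}

/-- `f` is traceable if some countable linkage containing it forces the joint `f` to be at `f x`
whenever the input parameter is `x`. -/
def Traceable (f : C(I, ℂ)) : Prop :=
  ∃ V : Set C(I, ℂ), V.Countable ∧ baseJoints ⊆ V ∧ f ∈ V ∧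
    ∀ s q, IsDrivenFlex V s q → ∀ t, q t f = f (s t)

namespace IsDrivenFlex

variable {V W : Set C(I, ℂ)} {s : I → I} {q : I → C(I, ℂ) → ℂ}

theorem mono (h : IsDrivenFlex W s q) (hVW : V ⊆ W) : IsDrivenFlex V s q where
  start f hf := h.start f (hVW hf)
  cont f hf := h.cont f (hVW hf)
  bar t f hf g hg := h.bar t f (hVW hf) g (hVW hg)
  zero := h.zero
  one := h.one
  input := h.input

theorem norm_sub_eq (h : IsDrivenFlex V s q) {f g : C(I, ℂ)} (hf : f ∈ V) (hg : g ∈ V) {c : ℝ}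
    (hc : ∀ x, ‖f x - g x‖ = c) (t : I) : ‖q t f - q t g‖ = c := by
  rw [h.bar t f hf g hg fun x => by rw [hc, hc], hc]

theorem s_eq (h : IsDrivenFlex V s q) (t : I) : (s t : ℝ) = (q t inputPath).re - 1 := by
  rw [h.input]
  simp [inputPath]

theorem continuous_s (h : IsDrivenFlex V s q) (hV : baseJoints ⊆ V) : Continuous s := by
  rw [continuous_induced_rng]
  have : (Subtype.val ∘ s) = fun t => (q t inputPath).re - 1 := funext h.s_eq
  rw [this]
  have := h.cont inputPath (hV (by simp [baseJoints]))
  fun_prop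

theorem s_zero (h : IsDrivenFlex V s q) (hV : baseJoints ⊆ V) : s 0 = 0 := by
  ext
  rw [h.s_eq, h.start _ (hV (by simp [baseJoints]))]
  simp [inputPath]

end IsDrivenFlex

/-- Linkages forcing the members of a countable set `A` can be united with further joints `B`. -/
theorem traceable_of {A B : Set C(I, ℂ)} (hA : A.Countable) (hB : B.Countable)
    (hAT : ∀ f ∈ A, Traceable f) {h : C(I, ℂ)} (hh : h ∈ B)
    (H : ∀ V s q, baseJoints ⊆ V → A ⊆ V → B ⊆ V → IsDrivenFlex V s q →
      (∀ f ∈ A, ∀ t, q t f = f (s t)) → ∀ t, q t h = h (s t)) : Traceable h := by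
  choose! U hU hbase hmem hforce using hAT
  have hAU : ∀ f ∈ A, U f ⊆ ⋃ f ∈ A, U f := fun f hf => Set.subset_biUnion_of_mem hf
  refine ⟨(⋃ f ∈ A, U f) ∪ B ∪ baseJoints, ?_, Set.subset_union_right,
    .inl (.inr hh), fun s q hq => ?_⟩
  · refine ((hA.biUnion hU).union hB).union ?_
    simp [baseJoints]
  · refine H _ s q Set.subset_union_right (fun f hf => .inl (.inl (hAU f hf (hmem f hf))))
      (fun f hf => .inl (.inr hf)) hq fun f hf => hforce f hf s q (hq.mono ?_)
    exact fun g hg => .inl (.inl (hAU f hf hg))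

theorem traceable_zero : Traceable 0 :=
  ⟨baseJoints, by simp [baseJoints], subset_rfl, by simp [baseJoints], fun s q h t => by
    simp [h.zero]⟩

theorem traceable_one : Traceable 1 :=
  ⟨baseJoints, by simp [baseJoints], subset_rfl, by simp [baseJoints], fun s q h t => by
    simp [h.one]⟩

theorem traceable_inputPath : Traceable inputPath :=
  ⟨baseJoints, by simp [baseJoints], subset_rfl, by simp [baseJoints], fun s q h t => h.input t⟩

/-! ### Elementary linkages -/

open ComplexConjugate

/-- The lengths `‖w‖` and `‖w - d‖` determine the component of `w` along `d`, and the component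
across `d` up to sign. -/
theorem conj_mul_eq_of_norm_eq {d w w' : ℂ} (h₁ : ‖w'‖ = ‖w‖) (h₂ : ‖w' - d‖ = ‖w - d‖) :
    (conj d * w').re = (conj d * w).re ∧ (conj d * w').im ^ 2 = (conj d * w).im ^ 2 := by
  have h₁' : ‖w'‖ ^ 2 = ‖w‖ ^ 2 := by rw [h₁]
  have h₂' : ‖w' - d‖ ^ 2 = ‖w - d‖ ^ 2 := by rw [h₂]
  simp only [Complex.sq_norm, Complex.normSq_apply, Complex.sub_re, Complex.sub_im] at h₁' h₂'
  have hre : (conj d * w').re = (conj d * w).re := by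
    simp only [Complex.mul_re, Complex.conj_re, Complex.conj_im]
    linarith
  refine ⟨hre, ?_⟩
  have key : ∀ z : ℂ, (conj d * z).im ^ 2
      = (d.re * d.re + d.im * d.im) * (z.re * z.re + z.im * z.im) - (conj d * z).re ^ 2 := by
    intro z
    simp only [Complex.mul_re, Complex.mul_im, Complex.conj_re, Complex.conj_im]
    ring
  rw [key, key, hre, h₁']

/-- A point on the line through `f` and `g` is determined by its distances from `f` and `g`. -/
theorem eq_of_norm_eq_of_collinear {f g p : ℂ} {r : ℝ}
    (h₁ : ‖p - f‖ = ‖r * (g - f)‖) (h₂ : ‖p - g‖ = ‖r * (g - f) - (g - f)‖) :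
    p = f + r * (g - f) := by
  have h₂' : ‖p - f - (g - f)‖ = ‖r * (g - f) - (g - f)‖ := by rw [← h₂]; congr 1; ring
  obtain ⟨hre, him⟩ := conj_mul_eq_of_norm_eq h₁ h₂'
  have him0 : (conj (g - f) * (r * (g - f))).im = 0 := by
    simp only [Complex.mul_re, Complex.mul_im, Complex.conj_re, Complex.conj_im,
      Complex.ofReal_re, Complex.ofReal_im]
    ring
  rw [him0, zero_pow two_ne_zero, pow_eq_zero_iff two_ne_zero] at him
  have heq : conj (g - f) * (p - f) = conj (g - f) * (r * (g - f)) :=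
    Complex.ext hre (him.trans him0.symm)
  by_cases hgf : g - f = 0
  · rw [hgf, mul_zero, norm_zero, norm_eq_zero] at h₁
    rw [hgf, mul_zero, add_zero]
    exact sub_eq_zero.1 h₁
  · have := mul_left_cancel₀ ((map_ne_zero (starRingEnd ℂ)).2 hgf) heq
    rw [← this]; ring

/-- A joint `h` joined by bars to two traceable joints `f` and `g` is traceable provided that
`f x`, `g x`, `h x` are never collinear, since then it cannot pass continuously to its mirror image
in the line through `f x` and `g x`. -/
theorem Traceable.of_noncollinear {f g h : C(I, ℂ)} (hf : Traceable f) (hg : Traceable g)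
    {c₁ c₂ : ℝ} (h₁ : ∀ x, ‖h x - f x‖ = c₁) (h₂ : ∀ x, ‖h x - g x‖ = c₂)
    (hne : ∀ x, (conj (g x - f x) * (h x - f x)).im ≠ 0) : Traceable h := by
  refine traceable_of (A := {f, g}) (B := {h}) (by simp) (by simp) (by simp [hf, hg])
    (Set.mem_singleton h) fun V s q hV hA hB hq hfg => ?_
  have hfV : f ∈ V := hA (by simp)
  have hgV : g ∈ V := hA (by simp)
  have hhV : h ∈ V := hB (by simp)
  have hqf : ∀ t, q t f = f (s t) := hfg f (by simp)
  have hqg : ∀ t, q t g = g (s t) := hfg g (by simp)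
  have hs := hq.continuous_s hV
  have key : ∀ t, (conj (g (s t) - f (s t)) * (q t h - f (s t))).re
        = (conj (g (s t) - f (s t)) * (h (s t) - f (s t))).re ∧
      (conj (g (s t) - f (s t)) * (q t h - f (s t))).im ^ 2
        = (conj (g (s t) - f (s t)) * (h (s t) - f (s t))).im ^ 2 := by
    intro t
    apply conj_mul_eq_of_norm_eq
    · rw [← hqf, hq.norm_sub_eq hhV hfV h₁, hqf, h₁]
    · rw [sub_sub_sub_cancel_right, sub_sub_sub_cancel_right, ← hqg,
        hq.norm_sub_eq hhV hgV h₂, hqg, h₂]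
  have hcont := hq.cont h hhV
  have heq : Set.EqOn (fun t => (conj (g (s t) - f (s t)) * (q t h - f (s t))).im)
      (fun t => (conj (g (s t) - f (s t)) * (h (s t) - f (s t))).im) Set.univ := by
    refine isPreconnected_univ.eq_of_sq_eq (y := 0) (Continuous.continuousOn ?_)
      (Continuous.continuousOn ?_) (fun t _ => (key t).2) (fun _ => hne _) trivial ?_
    · fun_prop
    · fun_prop
    · simp only [hq.start h hhV, hq.s_zero hV]
  intro t
  have hmul := Complex.ext (key t).1 (heq (Set.mem_univ t))
  have hd : conj (g (s t) - f (s t)) ≠ 0 := fun h0 => hne (s t) (by rw [h0]; simp)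
  exact sub_left_injective (mul_left_cancel₀ hd hmul)

/-- A point at a fixed position on a bar is traceable. -/
theorem Traceable.of_collinear {f g h : C(I, ℂ)} (hf : Traceable f) (hg : Traceable g)
    {c : ℝ} (hc : ∀ x, ‖g x - f x‖ = c) (r : ℝ) (hh : ∀ x, h x = f x + r * (g x - f x)) :
    Traceable h := by
  refine traceable_of (A := {f, g}) (B := {h}) (by simp) (by simp) (by simp [hf, hg])
    (Set.mem_singleton h) fun V s q hV hA hB hq hfg t => ?_
  have hfV : f ∈ V := hA (by simp)
  have hgV : g ∈ V := hA (by simp)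
  have hhV : h ∈ V := hB (by simp)
  have hqf : ∀ t, q t f = f (s t) := hfg f (by simp)
  have hqg : ∀ t, q t g = g (s t) := hfg g (by simp)
  rw [hh]
  apply eq_of_norm_eq_of_collinear
  · rw [← hqf, hq.norm_sub_eq hhV hfV (c := |r| * c), hqf, norm_mul, hc, Complex.norm_real,
      Real.norm_eq_abs]
    intro x
    rw [hh, add_sub_cancel_left, norm_mul, hc, Complex.norm_real, Real.norm_eq_abs]
  · have hfac : ∀ d : ℂ, r * d - d = ((r - 1 : ℝ) : ℂ) * d := fun d => by push_cast; ring
    rw [← hqg, hq.norm_sub_eq hhV hgV (c := |r - 1| * c), hqg, hfac, norm_mul, hc,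
      Complex.norm_real, Real.norm_eq_abs]
    intro x
    rw [hh, add_sub_assoc, add_comm, sub_add_eq_add_sub, ← sub_sub_sub_cancel_right _ _ (f x)]
    rw [show r * (g x - f x) + f x - f x - (g x - f x) = r * (g x - f x) - (g x - f x) by ring,
      hfac, norm_mul, hc, Complex.norm_real, Real.norm_eq_abs]

/-- The brace of a parallelogram: `a` and `a + e` cannot both have the norm of their midpoint. -/
theorem eq_zero_of_norm_midpoint {a e : ℂ} {c : ℝ} (h₀ : ‖a‖ = c) (h₁ : ‖a + e‖ = c)
    (h₂ : ‖a + e / 2‖ = c) : e = 0 := by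
  have h := parallelogram_law_with_norm ℝ (a + e / 2) (e / 2)
  rw [add_assoc, add_halves, add_sub_cancel_right, h₀, h₁, h₂] at h
  have : ‖e / 2‖ = 0 := by nlinarith [norm_nonneg (e / 2)]
  simpa using this

/-- The fourth corner of a parallelogram of bars is traceable. The parallelogram is braced by a
further bar joining the midpoints of two opposite sides, so that it cannot turn into a crossed
quadrilateral even when it becomes flat. -/
theorem Traceable.parallelogram {f g h : C(I, ℂ)} (hf : Traceable f) (hg : Traceable g)
    (hh : Traceable h) {c₁ c₂ : ℝ} (h₁ : ∀ x, ‖g x - f x‖ = c₁) (h₂ : ∀ x, ‖h x - f x‖ = c₂) :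
    Traceable (g + h - f) := by
  set m : C(I, ℂ) := f + ((1 / 2 : ℝ) : ℂ) • (g - f) with hm
  set n : C(I, ℂ) := h + ((1 / 2 : ℝ) : ℂ) • (g - f) with hn
  set k : C(I, ℂ) := g + h - f with hk
  have hmT : Traceable m := hf.of_collinear hg h₁ (1 / 2) fun x => by simp [hm]
  refine traceable_of (A := {f, g, h, m}) (B := {k, n}) (by simp) (by simp)
    (by simp [hf, hg, hh, hmT]) (by simp) fun V s q hV hA hB hq hfg t => ?_
  have hfV : f ∈ V := hA (by simp)
  have hgV : g ∈ V := hA (by simp)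
  have hhV : h ∈ V := hA (by simp)
  have hmV : m ∈ V := hA (by simp)
  have hkV : k ∈ V := hB (by simp)
  have hnV : n ∈ V := hB (by simp)
  have hqg : q t g = g (s t) := hfg g (by simp) t
  have hqh : q t h = h (s t) := hfg h (by simp) t
  have hqm : q t m = m (s t) := hfg m (by simp) t
  have e₁ : ‖q t n - q t h‖ = 1 / 2 * c₁ :=
    hq.norm_sub_eq hnV hhV (fun x => by simp [hn, h₁]) t
  have e₂ : ‖q t n - q t k‖ = 1 / 2 * c₁ := by
    refine hq.norm_sub_eq hnV hkV (fun x => ?_) t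
    have : n x - k x = ((-(1 / 2) : ℝ) : ℂ) * (g x - f x) := by simp [hn, hk]; ring
    rw [this, norm_mul, h₁]; simp
  have e₃ : ‖q t k - q t h‖ = c₁ :=
    hq.norm_sub_eq hkV hhV (fun x => by rw [← h₁ x]; congr 1; simp [hk]; ring) t
  have e₄ : ‖q t n - q t m‖ = c₂ :=
    hq.norm_sub_eq hnV hmV (fun x => by rw [← h₂ x]; congr 1; simp [hn, hm]) t
  have e₅ : ‖q t k - q t g‖ = c₂ :=
    hq.norm_sub_eq hkV hgV (fun x => by rw [← h₂ x]; congr 1; simp [hk]; ring) t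
  have hmid : q t n = q t h + ((1 / 2 : ℝ) : ℂ) * (q t k - q t h) := by
    apply eq_of_norm_eq_of_collinear
    · rw [e₁, norm_mul, e₃]; simp
    · rw [e₂, show ((1 / 2 : ℝ) : ℂ) * (q t k - q t h) - (q t k - q t h)
        = ((-(1 / 2) : ℝ) : ℂ) * (q t k - q t h) by push_cast; ring, norm_mul, e₃]
      simp
  have hkx : k (s t) = g (s t) + h (s t) - f (s t) := rfl
  have hmx : m (s t) = f (s t) + ((1 / 2 : ℝ) : ℂ) * (g (s t) - f (s t)) := rfl
  have hz : q t k - k (s t) = 0 := by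
    refine eq_zero_of_norm_midpoint (a := h (s t) - f (s t)) (c := c₂) (h₂ _) ?_ ?_
    · rw [← e₅, hqg]; congr 1; rw [hkx]; ring
    · rw [← e₄, hqm, hmid, hqh]; congr 1; rw [hkx, hmx]; push_cast; ring
  exact sub_eq_zero.1 hz

/-! ### Sums of bars of constant length -/

/-- Traceable functions of constant norm, the joints joined by a bar to the fixed joint `0`. -/
def radialJoints : Set C(I, ℂ) := {v | Traceable v ∧ ∃ c : ℝ, ∀ x, ‖v x‖ = c}

/-- Parallelograms transport the bar from `0` to `v` along a path of bars. -/
theorem traceable_of_mem_closure {f : C(I, ℂ)} (hf : f ∈ AddSubmonoid.closure radialJoints) :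
    Traceable f ∧ ∀ v ∈ radialJoints, Traceable (f + v) := by
  induction hf using AddSubmonoid.closure_induction_right with
  | zero => exact ⟨traceable_zero, fun v hv => by simpa using hv.1⟩
  | add_right f _ u hu ih =>
    refine ⟨ih.2 u hu, fun v hv => ?_⟩
    obtain ⟨a, ha⟩ := hu.2
    obtain ⟨b, hb⟩ := hv.2
    have := ih.1.parallelogram (ih.2 u hu) (ih.2 v hv) (c₁ := a) (c₂ := b)
      (fun x => by simp [ha]) (fun x => by simp [hb])
    rwa [show f + u + (f + v) - f = f + u + v by abel] at this

theorem smul_mem_radialJoints {v : C(I, ℂ)} (hv : v ∈ radialJoints) (c : ℂ) :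
    c • v ∈ radialJoints := by
  obtain ⟨hT, r, hr⟩ := hv
  refine ⟨?_, ‖c‖ * r, fun x => by simp [hr]⟩
  by_cases hr0 : r = 0
  · have : c • v = 0 := by
      ext x
      have := hr x
      rw [hr0, norm_eq_zero] at this
      simp [this]
    exact this ▸ traceable_zero
  have key : ∀ a : ℂ, a.im ≠ 0 → Traceable (a • v) := by
    intro a ha
    refine traceable_zero.of_noncollinear hT (c₁ := ‖a‖ * r) (c₂ := ‖a - 1‖ * r)
      (fun x => by simp [hr]) (fun x => ?_) (fun x => ?_)
    · rw [← hr x, ← norm_mul]; congr 1; simp; ring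
    · have : conj (v x - (0 : C(I, ℂ)) x) * ((a • v) x - (0 : C(I, ℂ)) x)
          = a * ((‖v x‖ ^ 2 : ℝ) : ℂ) := by
        simp only [ContinuousMap.coe_zero, Pi.zero_apply, sub_zero, ContinuousMap.coe_smul,
          Pi.smul_apply, smul_eq_mul, Complex.ofReal_pow]
        rw [← Complex.conj_mul']; ring
      rw [this, Complex.im_mul_ofReal, hr]
      exact mul_ne_zero ha (pow_ne_zero 2 hr0)
  by_cases hc : c.im = 0
  -- A real multiple is the diagonal of the parallelogram spanned by two non-real multiples.
  · have := traceable_zero.parallelogram (key (c - Complex.I) (by simp [hc]))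
      (key Complex.I (by simp)) (c₁ := ‖c - Complex.I‖ * r) (c₂ := r)
      (fun x => by simp [hr]) (fun x => by simp [hr])
    have heq : (c - Complex.I) • v + Complex.I • v - 0 = c • v := by ext x; simp; ring
    rwa [heq] at this
  · exact key c hc

/-- Every linear combination of traceable functions of constant norm is traceable. -/
theorem traceable_of_mem_span {f : C(I, ℂ)} (hf : f ∈ Submodule.span ℂ radialJoints) :
    Traceable f := by
  refine (traceable_of_mem_closure ?_).1
  induction hf using Submodule.closure_induction with
  | zero => exact zero_mem _
  | add _ _ _ _ h₁ h₂ => exact add_mem h₁ h₂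
  | smul_mem c v hv => exact AddSubmonoid.subset_closure (smul_mem_radialJoints hv c)

/-! ### Bounding the valency -/

namespace PlanarFramework

variable {V : Type*}

/-- Displacements, from a copy of a joint, of that copy and of the two auxiliary joints of which it
is the midpoint. -/
noncomputable def copyOffset : Fin 3 → Plane :=
  ![0, EuclideanSpace.single 0 1, -EuclideanSpace.single 0 1]

theorem copyOffset_injective : Function.Injective copyOffset := by
  have h : (EuclideanSpace.single 0 1 : Plane) ≠ 0 := by simp
  have h' : (EuclideanSpace.single 0 1 : Plane) ≠ -EuclideanSpace.single 0 1 := fun e => by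
    have := congrArg (fun p : Plane => p 0) e
    norm_num at this
  intro i j hij
  fin_cases i <;> fin_cases j <;> simp_all [copyOffset, eq_comm]

/-- The bars, in one of their two directions, of the framework `F.expand` below. -/
inductive ExpandRel [Encodable V] (F : PlanarFramework V) : V × ℕ × Fin 3 → V × ℕ × Fin 3 → Prop
  | bar {v w : V} (h : F.graph.Adj v w) :
      ExpandRel F (v, Encodable.encode w, 0) (w, Encodable.encode v, 0)
  | side (v : V) (n : ℕ) : ExpandRel F (v, n, 1) (v, n, 2)
  | arm (v : V) (n : ℕ) {i : Fin 3} (hi : i ≠ 0) : ExpandRel F (v, n, 0) (v, n, i)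
  | arm_succ (v : V) (n : ℕ) {i : Fin 3} (hi : i ≠ 0) : ExpandRel F (v, n + 1, 0) (v, n, i)

/-- Each joint `v` is replaced by copies `(v, n, 0)`, `n : ℕ`. The copies `(v, n, 0)` and
`(v, n + 1, 0)` are held together by being the midpoint of the same pair of auxiliary joints
`(v, n, 1)`, `(v, n, 2)`. The copy of `v` numbered by the code of `w` serves only to carry the bar
from `v` to `w`. -/
noncomputable def expand [Encodable V] (F : PlanarFramework V) :
    PlanarFramework (V × ℕ × Fin 3) where
  graph := SimpleGraph.fromRel F.ExpandRel
  place x := F.place x.1 + copyOffset x.2.2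
  place_ne := by
    have key : ∀ x y, F.ExpandRel x y →
        F.place x.1 + copyOffset x.2.2 ≠ F.place y.1 + copyOffset y.2.2 := by
      intro x y h
      induction h with
      | bar h => simpa using F.place_ne h
      | side v n => simpa using copyOffset_injective.ne (by decide)
      | arm v n hi => simpa using copyOffset_injective.ne hi.symm
      | arm_succ v n hi => simpa using copyOffset_injective.ne hi.symm
    intro x y h
    rcases (SimpleGraph.fromRel_adj _ _ _).1 h with ⟨-, h | h⟩
    · exact key x y h
    · exact (key y x h).symm

variable [Encodable V] (F : PlanarFramework V)

theorem ExpandRel.adj {F : PlanarFramework V} {x y : V × ℕ × Fin 3} (h : F.ExpandRel x y) :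
    F.expand.graph.Adj x y := by
  refine (SimpleGraph.fromRel_adj _ _ _).2 ⟨?_, .inl h⟩
  induction h with
  | bar h => simp [h.ne]
  | side v n => simp
  | arm v n hi => simpa using hi.symm
  | arm_succ v n hi => simp

theorem expand_place_copy (v : V) (n : ℕ) : F.expand.place (v, n, 0) = F.place v := by
  simp [expand, copyOffset]

theorem expand_valencyLE : F.expand.ValencyLE 7 := by
  classical
  rintro ⟨v, n, i⟩
  set S : Set (V × ℕ × Fin 3) := {x | ∃ w, Encodable.encode w = n ∧ x = (w, Encodable.encode v, 0)}
  set T : Finset (V × ℕ × Fin 3) :=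
    {(v, n, 0), (v, n + 1, 0), (v, n, 1), (v, n, 2), (v, n - 1, 1), (v, n - 1, 2)}
    with hT
  have hS : S.encard ≤ 1 := by
    rw [Set.encard_le_one_iff]
    rintro _ _ ⟨w, hw, rfl⟩ ⟨w', hw', rfl⟩
    rw [Encodable.encode_injective (hw.trans hw'.symm)]
  have hT6 : (T : Set (V × ℕ × Fin 3)).encard ≤ 6 := by
    rw [Set.encard_coe_eq_coe_finsetCard]
    exact_mod_cast Finset.card_le_six
  have hsub : F.expand.graph.neighborSet (v, n, i) ⊆ S ∪ T := by
    intro y hy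
    have hfin : ∀ i : Fin 3, i ≠ 0 → i = 1 ∨ i = 2 := by decide
    rcases (SimpleGraph.fromRel_adj _ _ _).1 hy with ⟨-, h | h⟩
    · cases h with
      | bar h => exact .inl ⟨_, rfl, rfl⟩
      | side => simp [hT]
      | arm _ _ hi => rcases hfin _ hi with rfl | rfl <;> simp [hT]
      | arm_succ _ _ hi => rcases hfin _ hi with rfl | rfl <;> simp [hT]
    · cases h with
      | bar h => exact .inl ⟨_, rfl, rfl⟩
      | side => simp [hT]
      | arm _ _ hi => simp [hT]
      | arm_succ _ _ hi => simp [hT]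
  calc _ ≤ (S ∪ T).encard := Set.encard_le_encard hsub
    _ ≤ S.encard + (T : Set (V × ℕ × Fin 3)).encard := Set.encard_union_le _ _
    _ ≤ 1 + 6 := add_le_add hS hT6
    _ = ((7 : ℕ) : ℕ∞) := by norm_num

variable {F}

theorem IsContinuousMotion.dist_expandRel {q : I → V × ℕ × Fin 3 → Plane}
    (h : F.expand.IsContinuousMotion q) {x y : V × ℕ × Fin 3} (hxy : F.ExpandRel x y) (t : I) :
    dist (q t x) (q t y) =
      dist (F.place x.1 + copyOffset x.2.2) (F.place y.1 + copyOffset y.2.2) :=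
  h.dist_eq t hxy.adj

/-- All copies of a joint move together: two consecutive ones are the midpoint of the same pair. -/
theorem IsContinuousMotion.copy_eq {q : I → V × ℕ × Fin 3 → Plane}
    (h : F.expand.IsContinuousMotion q) (t : I) (v : V) (n : ℕ) :
    q t (v, n, 0) = q t (v, 0, 0) := by
  induction n with
  | zero => rfl
  | succ n ih =>
    rw [← ih]
    have h0 : ‖(EuclideanSpace.single 0 1 : Plane)‖ = 1 := by simp
    have hside : dist (q t (v, n, 1)) (q t (v, n, 2)) = 2 := by
      rw [h.dist_expandRel (.side v n), dist_add_left, dist_eq_norm]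
      simp only [copyOffset, Matrix.cons_val, sub_neg_eq_add, ← two_smul ℝ, norm_smul, h0]
      norm_num
    have hmid : ∀ p, dist p (q t (v, n, 1)) = 1 → dist p (q t (v, n, 2)) = 1 →
        p = midpoint ℝ (q t (v, n, 1)) (q t (v, n, 2)) := by
      intro p h₁ h₂
      apply eq_midpoint_of_dist_eq_half
      · rw [dist_comm, h₁, hside]; norm_num
      · rw [h₂, hside]; norm_num
    have h1 : (1 : Fin 3) ≠ 0 := by decide
    have h2 : (2 : Fin 3) ≠ 0 := by decide
    rw [hmid (q t (v, n, 0)), hmid (q t (v, n + 1, 0))]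
    · rw [h.dist_expandRel (.arm_succ v n h1), dist_add_left]; simp [copyOffset]
    · rw [h.dist_expandRel (.arm_succ v n h2), dist_add_left]; simp [copyOffset]
    · rw [h.dist_expandRel (.arm v n h1), dist_add_left]; simp [copyOffset]
    · rw [h.dist_expandRel (.arm v n h2), dist_add_left]; simp [copyOffset]

theorem IsContinuousMotion.of_expand {q : I → V × ℕ × Fin 3 → Plane}
    (h : F.expand.IsContinuousMotion q) : F.IsContinuousMotion fun t v => q t (v, 0, 0) where
  start v := by rw [h.start, expand_place_copy]
  continuous_joint v := h.continuous_joint _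
  dist_eq t v w hvw := by
    rw [← h.copy_eq t v (Encodable.encode w), ← h.copy_eq t w (Encodable.encode v),
      h.dist_expandRel (.bar hvw)]
    simp

theorem IsContinuousMotion.expand {q : I → V → Plane} (h : F.IsContinuousMotion q) :
    F.expand.IsContinuousMotion fun t x => q t x.1 + copyOffset x.2.2 where
  start x := by rw [h.start]; rfl
  continuous_joint x := (h.continuous_joint x.1).add continuous_const
  dist_eq := by
    have key : ∀ t x y, F.ExpandRel x y → dist (q t x.1 + copyOffset x.2.2)
        (q t y.1 + copyOffset y.2.2) = dist (F.expand.place x) (F.expand.place y) := by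
      intro t x y hxy
      change _ = dist (F.place x.1 + copyOffset x.2.2) (F.place y.1 + copyOffset y.2.2)
      induction hxy with
      | bar hvw => simpa using h.dist_eq t hvw
      | side => simp only [dist_add_left]
      | arm => simp only [dist_add_left]
      | arm_succ => simp only [dist_add_left]
    intro t x y hxy
    rcases (SimpleGraph.fromRel_adj _ _ _).1 hxy with ⟨-, hxy | hxy⟩
    · exact key t x y hxy
    · rw [dist_comm, key t y x hxy, dist_comm]

end PlanarFramework

/-! ### Cranks and uniform limits -/

/-- The square of the abscissa `(1 + x) / 2` of the cranks. -/
noncomputable def abscissaSq : C(I, ℝ) := ⟨fun x => ((1 + x) / 2) ^ 2, by fun_prop⟩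

theorem abscissaSq_nonneg (x : I) : 0 ≤ abscissaSq x := sq_nonneg _

theorem abscissaSq_le_one (x : I) : abscissaSq x ≤ 1 := by
  have := x.2.1
  have := x.2.2
  exact pow_le_one₀ (by linarith) (by linarith)

theorem abscissaSq_injective : Function.Injective abscissaSq := by
  intro x y h
  have hx := x.2.1
  have hy := y.2.1
  have := (pow_left_inj₀ (by linarith) (by linarith) two_ne_zero).1
    (show ((1 + (x : ℝ)) / 2) ^ 2 = ((1 + (y : ℝ)) / 2) ^ 2 from h)
  exact Subtype.ext (by linarith)

/-- The apex, above (`κ = 1`) or below (`κ = -1`) the real axis, of the isosceles triangle on the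
base from `0` to `1 + x` with legs of length `1 / √ε`. -/
noncomputable def crank (ε κ : ℝ) : C(I, ℂ) :=
  ⟨fun x => (((1 + x) / 2 : ℝ) : ℂ) + ((κ * √(ε⁻¹ - abscissaSq x) : ℝ) : ℂ) * Complex.I,
    by fun_prop⟩

theorem crank_mem_radialJoints {ε κ : ℝ} (hε : 0 < ε) (hε' : ε ≤ 1 / 2) (hκ : κ ^ 2 = 1) :
    crank ε κ ∈ radialJoints := by
  have hinv : 2 ≤ ε⁻¹ := by
    rw [le_inv_comm₀ two_pos hε]; linarith
  have hpos : ∀ x, 0 < ε⁻¹ - abscissaSq x := fun x => by linarith [abscissaSq_le_one x]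
  have hnorm : ∀ x (a : ℝ), a ^ 2 = abscissaSq x →
      ‖(a : ℂ) + ((κ * √(ε⁻¹ - abscissaSq x) : ℝ) : ℂ) * Complex.I‖ = √ε⁻¹ := by
    intro x a ha
    rw [Complex.norm_add_mul_I, mul_pow, hκ, Real.sq_sqrt (hpos x).le, ha]
    congr 1; ring
  have h₀ : ∀ x, ‖crank ε κ x‖ = √ε⁻¹ := fun x => hnorm x _ rfl
  refine ⟨?_, _, h₀⟩
  refine traceable_zero.of_noncollinear traceable_inputPath (fun x => ?_)
    (fun x => ?_) (fun x => ?_) (c₁ := √ε⁻¹) (c₂ := √ε⁻¹)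
  · simpa using h₀ x
  · rw [← hnorm x (-((1 + x) / 2)) (by rw [neg_sq]; rfl)]
    congr 1
    simp only [crank, inputPath, ContinuousMap.coe_mk]
    push_cast
    ring
  · have hκ0 : κ ≠ 0 := by rintro rfl; norm_num at hκ
    have hx : (1 + (x : ℝ)) ≠ 0 := by have := x.2.1; positivity
    have : conj (inputPath x - (0 : C(I, ℂ)) x) * (crank ε κ x - (0 : C(I, ℂ)) x)
        = ((1 + x : ℝ) : ℂ) * crank ε κ x := by
      simp [inputPath]
    rw [this, Complex.im_ofReal_mul, crank]
    simpa using ⟨hx, hκ0, (Real.sqrt_pos.2 (hpos x)).ne'⟩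

theorem dense_span_radialJoints : (Submodule.span ℂ radialJoints).topologicalClosure = ⊤ := by
  set M := (Submodule.span ℂ radialJoints).topologicalClosure
  have hM : IsClosed (M : Set C(I, ℂ)) := Submodule.isClosed_topologicalClosure _
  let φ : C(I, ℝ) →L[ℝ] C(I, ℂ) := Complex.ofRealCLM.compLeftContinuous ℝ I
  have hφ : ∀ g x, φ g x = (g x : ℂ) := fun _ _ => rfl
  set W : Submodule ℝ C(I, ℝ) := (M.restrictScalars ℝ).comap φ.toLinearMap
  have hW : W = ⊤ := by
    refine eq_top_of_sqrt_mem (hM.preimage φ.continuous) (y := abscissaSq)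
      (fun x => by rw [abs_of_nonneg (abscissaSq_nonneg x)]; exact abscissaSq_le_one x)
      abscissaSq_injective fun ε hε hε' => ?_
    change φ (sqrtOneSub abscissaSq ε) ∈ M
    have heq : φ (sqrtOneSub abscissaSq ε)
        = ((√ε : ℝ) / (2 * Complex.I) : ℂ) • (crank ε 1 - crank ε (-1)) := by
      ext x
      have hsq : √(1 - ε * abscissaSq x) = √ε * √(ε⁻¹ - abscissaSq x) := by
        rw [← Real.sqrt_mul hε.le, mul_sub, mul_inv_cancel₀ hε.ne']
      simp only [hφ, sqrtOneSub, crank,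
        ContinuousMap.coe_mk, ContinuousMap.coe_smul, ContinuousMap.coe_sub, Pi.smul_apply,
        Pi.sub_apply, smul_eq_mul, hsq]
      have := Complex.I_ne_zero
      push_cast
      field_simp
      ring
    rw [heq]
    refine Submodule.le_topologicalClosure _ (Submodule.smul_mem _ _ (Submodule.sub_mem _ ?_ ?_))
    · exact Submodule.subset_span (crank_mem_radialJoints hε hε' (by norm_num))
    · exact Submodule.subset_span (crank_mem_radialJoints hε hε' (by norm_num))
  refine eq_top_iff.2 fun f _ => ?_
  have hmem : ∀ g : C(I, ℝ), φ g ∈ M := fun g => by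
    have : g ∈ W := hW ▸ Submodule.mem_top
    exact this
  have hf : f = φ ⟨fun x => (f x).re, by fun_prop⟩
      + Complex.I • φ ⟨fun x => (f x).im, by fun_prop⟩ := by
    ext x
    simp [hφ, mul_comm Complex.I, Complex.re_add_im]
  rw [hf]
  exact M.add_mem (hmem _) (M.smul_mem _ (hmem _))

/-- Two bars of length `ε` can join continuously moving points whose distance stays in `(0, 2ε]`. -/
theorem exists_elbow (f g : C(I, ℂ)) {ε : ℝ} (hε : 0 < ε) (h₀ : ∀ x, g x - f x ≠ 0)
    (h : ∀ x, ‖g x - f x‖ ≤ 2 * ε) :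
    ∃ b : C(I, ℂ), (∀ x, ‖b x - f x‖ = ε) ∧ ∀ x, ‖g x - b x‖ = ε := by
  have hn : ∀ x, ‖g x - f x‖ ≠ 0 := fun x => norm_ne_zero_iff.2 (h₀ x)
  have hτ : Continuous fun x => √((ε / ‖g x - f x‖) ^ 2 - 1 / 4) := by fun_prop (disch := exact hn _)
  have hnorm : ∀ x (a : ℝ), a ^ 2 = 1 / 4 →
      ‖(g x - f x) * (a + √((ε / ‖g x - f x‖) ^ 2 - 1 / 4) * Complex.I)‖ = ε := by
    intro x a ha
    have hpos : 0 < ‖g x - f x‖ := norm_pos_iff.2 (h₀ x)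
    have h1 : 1 / 2 ≤ ε / ‖g x - f x‖ := by
      rw [le_div_iff₀ hpos]; linarith [h x]
    have h2 : 0 ≤ (ε / ‖g x - f x‖) ^ 2 - 1 / 4 := by nlinarith
    rw [norm_mul, Complex.norm_add_mul_I, Real.sq_sqrt h2, ha, add_sub_cancel,
      Real.sqrt_sq (by positivity), mul_div_cancel₀ _ hpos.ne']
  refine ⟨⟨fun x => f x + (g x - f x) *
    ((1 / 2 : ℝ) + √((ε / ‖g x - f x‖) ^ 2 - 1 / 4) * Complex.I), by fun_prop⟩, fun x => ?_,
    fun x => ?_⟩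
  · refine Eq.trans ?_ (hnorm x (1 / 2) (by norm_num))
    congr 1
    simp only [ContinuousMap.coe_mk]
    ring
  · refine (norm_neg _).symm.trans (Eq.trans ?_ (hnorm x (-(1 / 2)) (by norm_num)))
    congr 1
    simp only [ContinuousMap.coe_mk]
    push_cast
    ring

/-- Every continuous function is traceable. The approximations are made to a small translate of `f`,
not to `f` itself, so that their difference from `f` does not vanish and the elbows of
`exists_elbow` exist. -/
theorem traceable (f : C(I, ℂ)) : Traceable f := by
  have happ : ∀ ε : ℝ, 0 < ε → ∃ g, Traceable g ∧ ∀ x, ‖f x - g x - ε‖ < ε := by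
    intro ε hε
    have hmem : f - ContinuousMap.const I (ε : ℂ) ∈
        closure (Submodule.span ℂ radialJoints : Set _) := by
      rw [← Submodule.topologicalClosure_coe, dense_span_radialJoints]; trivial
    obtain ⟨g, hg, hdist⟩ := Metric.mem_closure_iff.1 hmem ε hε
    refine ⟨g, traceable_of_mem_span hg, fun x => ?_⟩
    have := (ContinuousMap.dist_lt_iff hε).1 hdist x
    rw [dist_eq_norm] at this
    rwa [ContinuousMap.sub_apply, ContinuousMap.const_apply, sub_right_comm] at this
  have hpos : ∀ n : ℕ, (0 : ℝ) < 1 / ((n : ℝ) + 1) := fun n => Nat.one_div_pos_of_nat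
  choose g hgT hg using fun n : ℕ => happ _ (hpos n)
  have hle : ∀ n x, ‖f x - g n x‖ ≤ 2 * (1 / ((n : ℝ) + 1)) := by
    intro n x
    have h1 := norm_add_le (f x - g n x - (1 / ((n : ℝ) + 1) : ℝ)) (1 / ((n : ℝ) + 1) : ℝ)
    rw [sub_add_cancel, Complex.norm_real, Real.norm_of_nonneg (hpos n).le] at h1
    linarith [hg n x]
  have hne : ∀ n x, f x - g n x ≠ 0 := by
    intro n x h0
    have := hg n x
    rw [h0, zero_sub, norm_neg, Complex.norm_real, Real.norm_of_nonneg (hpos n).le] at this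
    exact lt_irrefl _ this
  choose b hbg hbf using fun n => exists_elbow (g n) f (hpos n) (hne n) (hle n)
  refine traceable_of (A := Set.range g) (B := insert f (Set.range b)) (Set.countable_range g)
    ((Set.countable_range b).insert f) (Set.forall_mem_range.2 hgT) (Set.mem_insert _ _)
    fun V s q hV hA hB hq hqg t => ?_
  have hfV : f ∈ V := hB (Set.mem_insert _ _)
  have hbV : ∀ n, b n ∈ V := fun n => hB (.inr ⟨n, rfl⟩)
  have hgV : ∀ n, g n ∈ V := fun n => hA ⟨n, rfl⟩
  have hbound : ∀ n : ℕ, ‖q t f - f (s t)‖ ≤ 4 * (1 / ((n : ℝ) + 1)) := by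
    intro n
    have e₁ := hq.norm_sub_eq hfV (hbV n) (hbf n) t
    have e₂ := hq.norm_sub_eq (hbV n) (hgV n) (hbg n) t
    rw [hqg _ ⟨n, rfl⟩] at e₂
    have h1 := norm_sub_le_norm_sub_add_norm_sub (q t f) (q t (b n)) (f (s t))
    have h2 := norm_sub_le_norm_sub_add_norm_sub (q t (b n)) (g n (s t)) (f (s t))
    rw [norm_sub_rev (g n (s t))] at h2
    linarith [hle n (s t)]
  have hlim := (tendsto_one_div_add_atTop_nhds_zero_nat (𝕜 := ℝ)).const_mul 4
  rw [mul_zero] at hlim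
  exact sub_eq_zero.1 (norm_le_zero_iff.1 (ge_of_tendsto' hlim hbound))

/-! ### The framework of a linkage of functions -/

/-- The identification of `ℂ` with the Euclidean plane. -/
noncomputable def planeEquiv : ℂ ≃ₗᵢ[ℝ] Plane := Complex.orthonormalBasisOneI.repr

theorem planeEquiv_ofReal (r : ℝ) : planeEquiv r = !₂[r, 0] := by
  ext i
  fin_cases i <;> simp [planeEquiv]

/-- The framework whose joints are the functions in `V` at their initial values, with a bar between
any two whose distance is constant. -/
noncomputable def functionFramework (V : Set C(I, ℂ)) : PlanarFramework V where
  graph :=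
    { Adj := fun f g => f ≠ g ∧ ∀ x, ‖f.1 x - g.1 x‖ = ‖f.1 0 - g.1 0‖
      symm := ⟨fun f g h => ⟨h.1.symm, fun x => by
        rw [norm_sub_rev, h.2 x, norm_sub_rev]⟩⟩
      loopless := ⟨fun f h => h.1 rfl⟩ }
  place f := planeEquiv (f.1 0)
  place_ne := by
    intro f g h heq
    refine h.1 (Subtype.ext (ContinuousMap.ext fun x => ?_))
    have := h.2 x
    rw [planeEquiv.injective heq, sub_self, norm_zero, norm_eq_zero] at this
    exact sub_eq_zero.1 this

theorem functionFramework_motion (V : Set C(I, ℂ)) :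
    (functionFramework V).IsContinuousMotion fun t f => planeEquiv (f.1 t) where
  start _ := rfl
  continuous_joint f := planeEquiv.continuous.comp f.1.continuous
  dist_eq t f g h := by
    simp only [functionFramework, planeEquiv.dist_map, dist_eq_norm]
    exact h.2 t

open Classical in
theorem IsDrivenFlex.of_motion {V : Set C(I, ℂ)} (hV : baseJoints ⊆ V) {s : I → I}
    {q : I → V → Plane} (h : (functionFramework V).IsContinuousMotion q)
    (h₀ : ∀ t, q t ⟨0, hV (by simp [baseJoints])⟩ = planeEquiv 0)
    (h₁ : ∀ t, q t ⟨1, hV (by simp [baseJoints])⟩ = planeEquiv 1)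
    (h₂ : ∀ t, q t ⟨inputPath, hV (by simp [baseJoints])⟩ = planeEquiv (inputPath (s t))) :
    IsDrivenFlex V s fun t f => if hf : f ∈ V then planeEquiv.symm (q t ⟨f, hf⟩) else 0 where
  start f hf := by simp [hf, h.start, functionFramework]
  cont f hf := by
    simp only [hf, dif_pos]
    exact planeEquiv.symm.continuous.comp (h.continuous_joint _)
  bar t f hf g hg hfg := by
    simp only [hf, hg, dif_pos]
    by_cases heq : f = g
    · subst heq; simp
    · rw [← dist_eq_norm, planeEquiv.symm.dist_map, h.dist_eq t (v := ⟨f, hf⟩) (w := ⟨g, hg⟩)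
        ⟨fun e => heq (congrArg Subtype.val e), hfg⟩, ← dist_eq_norm]
      exact planeEquiv.dist_map _ _
  zero t := by
    rw [dif_pos (hV (by simp [baseJoints])), h₀, planeEquiv.symm_apply_apply]
  one t := by
    rw [dif_pos (hV (by simp [baseJoints])), h₁, planeEquiv.symm_apply_apply]
  input t := by
    rw [dif_pos (hV (by simp [baseJoints])), h₂, planeEquiv.symm_apply_apply]

theorem theorem3 (γ : I → Plane) (hγ : Continuous γ) :
    ∃ (V : Type) (_ : Countable V) (_ : Infinite V) (F : PlanarFramework V)
      (v₁ v₂ vL vC : V),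
      [v₁, v₂, vL, vC].Nodup ∧
      (∃ d : ℕ, F.ValencyLE d) ∧
      F.place v₁ = !₂[(0 : ℝ), 0] ∧ F.place v₂ = !₂[(1 : ℝ), 0] ∧
      F.place vL = !₂[(1 : ℝ), 0] ∧ F.place vC = γ 0 ∧
      (∀ (q : I → V → Plane) (s : I → I), F.IsDrivenMotion v₁ v₂ vL s q →
        ∀ t : I, q t vC = γ (s t)) ∧
      (∃ q : I → V → Plane, F.IsDrivenMotion v₁ v₂ vL id q) := by
  set f : C(I, ℂ) := ⟨fun x => planeEquiv.symm (γ x), planeEquiv.symm.continuous.comp hγ⟩ with hf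
  obtain ⟨V, hVc, hV, hfV, hforce⟩ := traceable f
  have : Countable V := hVc.to_subtype
  have : Encodable V := Encodable.ofCountable V
  have h0V : (0 : C(I, ℂ)) ∈ V := hV (by simp [baseJoints])
  have h1V : (1 : C(I, ℂ)) ∈ V := hV (by simp [baseJoints])
  have hiV : inputPath ∈ V := hV (by simp [baseJoints])
  have : Nonempty V := ⟨⟨0, h0V⟩⟩
  have e₀ : planeEquiv 0 = !₂[(0 : ℝ), 0] := by simpa using planeEquiv_ofReal 0
  have e₁ : planeEquiv 1 = !₂[(1 : ℝ), 0] := by simpa using planeEquiv_ofReal 1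
  have ei : ∀ x : I, planeEquiv (inputPath x) = !₂[1 + (x : ℝ), 0] := fun x => by
    rw [← planeEquiv_ofReal]; simp [inputPath]
  have n₁ : (0 : C(I, ℂ)) ≠ 1 := zero_ne_one
  have n₂ : (0 : C(I, ℂ)) ≠ inputPath := fun h => by
    simpa [inputPath] using DFunLike.congr_fun h 0
  have n₃ : (1 : C(I, ℂ)) ≠ inputPath := fun h => by
    simpa [inputPath] using DFunLike.congr_fun h 1
  -- `f` may coincide with one of the base joints, so the traced joint is the copy numbered `1`.
  refine ⟨V × ℕ × Fin 3, inferInstance, inferInstance, (functionFramework V).expand,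
    (⟨0, h0V⟩, 0, 0), (⟨1, h1V⟩, 0, 0), (⟨inputPath, hiV⟩, 0, 0), (⟨f, hfV⟩, 1, 0), ?_,
    ⟨7, PlanarFramework.expand_valencyLE _⟩, ?_, ?_, ?_, ?_, fun q s hq t => ?_,
    _, (functionFramework_motion V).expand, fun t => ?_, fun t => ?_, fun t => ?_⟩
  · simp [n₁, n₂, n₃]
  · rw [PlanarFramework.expand_place_copy]; exact e₀
  · rw [PlanarFramework.expand_place_copy]; exact e₁
  · rw [PlanarFramework.expand_place_copy]; exact (ei 0).trans (by simp)
  · rw [PlanarFramework.expand_place_copy]; simp [functionFramework, hf]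
  · have h := hforce s _ (IsDrivenFlex.of_motion hV hq.motion.of_expand
      (fun t => by rw [hq.fixed₁, PlanarFramework.expand_place_copy]; rfl)
      (fun t => by rw [hq.fixed₂, PlanarFramework.expand_place_copy]; rfl)
      (fun t => by rw [hq.input, ei])) t
    rw [dif_pos hfV] at h
    rw [hq.motion.copy_eq]
    exact planeEquiv.symm.injective h
  · rfl
  · rfl
  · simpa [PlanarFramework.copyOffset] using ei t
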